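/- Consider the following two concurrent stochastic games between Max and Min, in which at every state both players simultaneously choose an action from $\{0,1\}$ and all transitions are deterministic. **Bad Match.** The states are $d,w,l,s,t$. If Max plays $a$ and Min plays $b$ at $d$, the next state is $w$ for $(a,b)=(1,1)$, $l$ for $(1,0)$, $t$ for $(0,1)$, and $s$ for $(0,0)$. From $s$ and $t$ the game returns to $d$; the states $w$ and $l$ are sinks. Max's objective is to visit the target set $\{w,s\}$ infinitely often. **Simplified Bad Match.** The same, except that the state $w$ is removed, the action pair $(1,1)$ leads from $d$ to $s$, and the target set is $\{s\}$. A strategy assigns to every finite history (a finite sequence of states and action pairs ending in the current state) a probability distribution on the player's actions. For an initial state $x$ and strategies $\sigma$ of Max and $\pi$ of Min let $\mathcal P_{x,\sigma,\pi}(E)$ be the probability of the objective $E$. The state $x$ has value $v$ if $\sup_\sigma\inf_\pi \mathcal P_{x,\sigma,\pi}(E)=\inf_\pi\sup_\sigma \mathcal P_{x,\sigma,\pi}(E)=v$, and then $\sigma$ is $\varepsilon$-optimal from $x$ if $\mathcal P_{x,\sigma,\pi}(E)\ge v-\varepsilon$ for all $\pi$. A Max strategy is *1-bit Markov* if its mixed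 action depends only on the current state and on a memory mode in $\mathbb N\times\{0,1\}$, where the mode after $n$ steps lies in $\{n\}\times\{0,1\}$ and is updated at each step from the old mode, the old state, the two actions played and the new state. In each of the two games the following holds. The state $d$ has value $1$, and for every $\varepsilon>0$ Max has an $\varepsilon$-optimal 1-bit Markov strategy from $d$ with deterministic memory updates which plays in phases of predetermined lengths: there are $0=L_0<L_1<L_2<\cdots$ such that, along every finite history starting in $d$, at each step $n$ of phase $i$ (that is, $L_i\le n<L_{i+1}$) the bit is $1$ if and only if $s$ was visited at some step $j$ with $L_i\le j\le n$; and at $d$ Max plays action $0$ if the bit is $1$, and a mixed action that depends only on $i$ if the bit is $0$. -/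

import Mathlib

open MeasureTheory ProbabilityTheory Filter
open scoped ENNReal

namespace StochGame

/-- A concurrent stochastic game with states `S` in which, at every state, the action sets of Max
and Min are the whole types `A` and `B`. The number `trans s a b s'` is `p(s,a,b)(s')`. -/
structure Game (S A B : Type) where
  trans : S → A → B → PMF S

/-- Histories `(s₀,a₀,b₀) ⋯ (sₙ₋₁,aₙ₋₁,bₙ₋₁) sₙ`: the one-state history `init s₀`, or a history
followed by the two chosen actions and the next state. -/
inductive History (S A B : Type) : Type
  | init (s : S) : History S A B
  | step (h : History S A B) (a : A) (b : B) (s : S) : History S A B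

namespace History

variable {S A B : Type}

/-- The first state of a history. -/
def first : History S A B → S
  | init s => s
  | step h _ _ _ => h.first

/-- The final state of a history. -/
def last : History S A B → S
  | init s => s
  | step _ _ _ s => s

/-- The number of steps of a history. -/
def len : History S A B → ℕ
  | init _ => 0
  | step h _ _ _ => h.len + 1

/-- `h.Visited x k`: some state `sⱼ` of `h = (s₀,a₀,b₀) ⋯ sₙ` with `k ≤ j ≤ n` equals `x`. -/
def Visited (x : S) (k : ℕ) : History S A B → Prop
  | init s => k ≤ 0 ∧ s = x
  | step h _ _ s => Visited x k h ∨ (k ≤ h.len + 1 ∧ s = x)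

end History

/-- A strategy for Max assigns a mixed action to every history. -/
abbrev MaxStrategy (S A B : Type) : Type := History S A B → PMF A

/-- A strategy for Min assigns a mixed action to every history. -/
abbrev MinStrategy (S A B : Type) : Type := History S A B → PMF B

/-- Infinite sequences `(s₀,a₀,b₀)(s₁,a₁,b₁) ⋯`. -/
abbrev Play (S A B : Type) : Type := ℕ → S × A × B

/-- The history of a play up to step `n`: `(s₀,a₀,b₀) ⋯ (sₙ₋₁,aₙ₋₁,bₙ₋₁) sₙ`. -/
def Play.hist {S A B : Type} (ω : Play S A B) : ℕ → History S A B
  | 0 => .init (ω 0).1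
  | n + 1 => .step (Play.hist ω n) (ω n).2.1 (ω n).2.2 (ω (n + 1)).1

/-- The history `(s₀,a₀,b₀) ⋯ (sₙ₋₁,aₙ₋₁,bₙ₋₁) sₙ` read off the first `n + 1` entries of a play. -/
def histOfPrefix {S A B : Type} (n : ℕ) (x : Finset.Iic n → S × A × B) : History S A B :=
  Play.hist (fun k => x ⟨min k n, Finset.mem_Iic.2 (min_le_right k n)⟩) n

section Measure

variable {S A B : Type}

/-- The distribution of the triple `(sₙ,aₙ,bₙ)` given the history `h` with final state `sₙ`:
the two actions are drawn independently from `σ h` and `π h`. -/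
noncomputable def stepPMF (σ : MaxStrategy S A B) (π : MinStrategy S A B) (h : History S A B) :
    PMF (S × A × B) :=
  (σ h).bind fun a => (π h).bind fun b => PMF.pure (h.last, a, b)

/-- The distribution of the next triple `(sₙ₊₁,aₙ₊₁,bₙ₊₁)`, when the current history is `h` and
the actions `a`, `b` have been drawn at its final state. -/
noncomputable def nextPMF (G : Game S A B) (σ : MaxStrategy S A B) (π : MinStrategy S A B)
    (h : History S A B) (a : A) (b : B) : PMF (S × A × B) :=
  (G.trans h.last a b).bind fun s' => stepPMF σ π (h.step a b s')

variable [Countable S] [Countable A] [Countable B]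
  [MeasurableSpace S] [MeasurableSpace A] [MeasurableSpace B]
  [DiscreteMeasurableSpace S] [DiscreteMeasurableSpace A] [DiscreteMeasurableSpace B]

/-- The transition kernel from the first `n + 1` entries of a play to the next entry. -/
noncomputable def playKernel (G : Game S A B) (σ : MaxStrategy S A B) (π : MinStrategy S A B)
    (n : ℕ) : Kernel (Finset.Iic n → S × A × B) (S × A × B) :=
  Kernel.ofFunOfCountable fun x =>
    (nextPMF G σ π (histOfPrefix n x)
      (x ⟨n, Finset.mem_Iic.2 le_rfl⟩).2.1 (x ⟨n, Finset.mem_Iic.2 le_rfl⟩).2.2).toMeasure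

instance (G : Game S A B) (σ : MaxStrategy S A B) (π : MinStrategy S A B) (n : ℕ) :
    IsMarkovKernel (playKernel G σ π n) :=
  ⟨fun _ => PMF.toMeasure.isProbabilityMeasure _⟩

/-- The probability measure on plays induced by the initial state `s₀` and the strategies
`σ` and `π`. -/
noncomputable def playMeasure (G : Game S A B) (s₀ : S) (σ : MaxStrategy S A B)
    (π : MinStrategy S A B) : Measure (Play S A B) :=
  Kernel.trajMeasure (X := fun _ => S × A × B) (stepPMF σ π (.init s₀)).toMeasure
    (playKernel G σ π)

/-- The lower value `sup_σ inf_π P(E)` of the state `s₀` for the objective `E`. -/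
noncomputable def lowerValue (G : Game S A B) (E : Set (Play S A B)) (s₀ : S) : ℝ≥0∞ :=
  ⨆ σ : MaxStrategy S A B, ⨅ π : MinStrategy S A B, playMeasure G s₀ σ π E

/-- The upper value `inf_π sup_σ P(E)` of the state `s₀` for the objective `E`. -/
noncomputable def upperValue (G : Game S A B) (E : Set (Play S A B)) (s₀ : S) : ℝ≥0∞ :=
  ⨅ π : MinStrategy S A B, ⨆ σ : MaxStrategy S A B, playMeasure G s₀ σ π E

/-- The state `s₀` has a value, namely `v`: the lower and the upper value both equal `v`. -/
def HasValue (G : Game S A B) (E : Set (Play S A B)) (s₀ : S) (v : ℝ≥0∞) : Prop :=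
  lowerValue G E s₀ = v ∧ upperValue G E s₀ = v

/-- `σ` is `ε`-optimal from `s₀`: the value `v` of `s₀` exists, and `σ` guarantees at least
`v - ε` against all strategies of Min. -/
def IsEpsOptimal (G : Game S A B) (E : Set (Play S A B)) (s₀ : S) (ε : ℝ)
    (σ : MaxStrategy S A B) : Prop :=
  ∃ v : ℝ≥0∞, HasValue G E s₀ v ∧
    ∀ π : MinStrategy S A B, v - ENNReal.ofReal ε ≤ playMeasure G s₀ σ π E

end Measure

/-- The Büchi objective: the plays that visit the target set `T` infinitely often. -/
def buchi {S : Type} (A B : Type) (T : Set S) : Set (Play S A B) :=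
  {ω | ∃ᶠ n in atTop, (ω n).1 ∈ T}

/-- A description of a Max strategy based on the set `M` of memory modes: an initial mode, the
choice of a mixed action, and the memory update. Memory updates are deterministic here (the
distribution over `M` is Dirac), so that the opponent knows the current mode: the memory is
public. -/
structure MemoryStrategy (S A B M : Type) where
  initMode : M
  act : M → S → PMF A
  update : S → M → A → B → S → M

namespace MemoryStrategy

variable {S A B M : Type}

/-- The memory mode after a history. -/
def mode (σ : MemoryStrategy S A B M) : History S A B → M
  | .init _ => σ.initMode
  | .step h a b s => σ.update h.last (σ.mode h) a b s

/-- The Max strategy `h ↦ act (mₙ, sₙ)` described by `σ`. -/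
noncomputable def toStrategy (σ : MemoryStrategy S A B M) : MaxStrategy S A B :=
  fun h => σ.act (σ.mode h) h.last

/-- A `1`-bit Markov strategy: the set of modes is `ℕ × {0,1}`, and the first component of the mode
is a step counter. -/
def IsOneBitMarkov (σ : MemoryStrategy S A B (ℕ × Bool)) : Prop :=
  ∀ h : History S A B, (σ.mode h).1 = h.len

/-- From the start state `d`, the strategy `σ` plays in phases of predetermined length: phase `i`
consists of the steps `n` with `start i ≤ n < start (i + 1)`. The bit of `σ` says whether the state
`x` has been visited in the current phase. At `d`, as long as the bit is not set, `σ` plays a mixed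
action that depends on the phase only; once it is set, `σ` plays the action `c` for the rest of the
phase. -/
def PlaysInPhases (σ : MemoryStrategy S A B (ℕ × Bool)) (d x : S) (c : A) : Prop :=
  ∃ (start : ℕ → ℕ) (α : ℕ → PMF A), start 0 = 0 ∧ StrictMono start ∧
    ∀ (i : ℕ) (h : History S A B), h.first = d → start i ≤ h.len → h.len < start (i + 1) →
      ((σ.mode h).2 = true ↔ h.Visited x (start i)) ∧
      (h.last = d →
        σ.toStrategy h = if (σ.mode h).2 = true then PMF.pure c else α i)

end MemoryStrategy

/-- The states of the Bad Match. -/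
inductive BadState : Type
  | d | w | l | s | t
  deriving DecidableEq

/-- The states of the Simplified Bad Match. -/
inductive SimpleState : Type
  | d | l | s | t
  deriving DecidableEq

instance : Fintype BadState := ⟨{.d, .w, .l, .s, .t}, fun x => by cases x <;> decide⟩

instance : Fintype SimpleState := ⟨{.d, .l, .s, .t}, fun x => by cases x <;> decide⟩

instance : MeasurableSpace BadState := ⊤

instance : DiscreteMeasurableSpace BadState := ⟨fun _ => trivial⟩

instance : MeasurableSpace SimpleState := ⊤

instance : DiscreteMeasurableSpace SimpleState := ⟨fun _ => trivial⟩

/-- The successor states in the Bad Match, where Max plays `a` and Min plays `b`. -/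
def badNext : BadState → Fin 2 → Fin 2 → BadState
  | .d, 1, 1 => .w
  | .d, 1, 0 => .l
  | .d, 0, 1 => .t
  | .d, 0, 0 => .s
  | .w, _, _ => .w
  | .l, _, _ => .l
  | .s, _, _ => .d
  | .t, _, _ => .d

/-- The successor states in the Simplified Bad Match, where Max plays `a` and Min plays `b`. -/
def simpleNext : SimpleState → Fin 2 → Fin 2 → SimpleState
  | .d, 1, 1 => .s
  | .d, 1, 0 => .l
  | .d, 0, 1 => .t
  | .d, 0, 0 => .s
  | .l, _, _ => .l
  | .s, _, _ => .d
  | .t, _, _ => .d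

/-- The Bad Match. -/
noncomputable def badMatch : Game BadState (Fin 2) (Fin 2) where
  trans x a b := PMF.pure (badNext x a b)

/-- The Simplified Bad Match. -/
noncomputable def simpleBadMatch : Game SimpleState (Fin 2) (Fin 2) where
  trans x a b := PMF.pure (simpleNext x a b)

/-- The objective of the Bad Match, with target set `{w, s}`. -/
def badObjective : Set (Play BadState (Fin 2) (Fin 2)) :=
  buchi (Fin 2) (Fin 2) {BadState.w, BadState.s}

/-- The objective of the Simplified Bad Match, with target set `{s}`. -/
def simpleObjective : Set (Play SimpleState (Fin 2) (Fin 2)) :=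
  buchi (Fin 2) (Fin 2) {SimpleState.s}

end StochGame

/-! Phase `i` lasts 3·4^i steps, and until `s` is seen in it Max plays action 1 at `d` with
probability r_i = ε/2^(i+1). If Min answers with 0, the play is either lost, with probability r_i,
or reaches `s`, after which Max plays 0 for the rest of the phase. So Max faces the danger of losing
at most once per phase, and the total probability of loss is at most ∑ r_i = ε. If Min instead plays
1 throughout phase `I`, every visit to `d` hits the target with probability r_I; the phase has room
for at least 4^I such trials, and all of them fail with probability at most (1 - r_I)^(4^I), which
tends to 0.

The potential `failBound` combines both cases. It is a supermartingale against every Min strategy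
(`failBound_step`, `lintegral_hist_le_of_supermartingale`), and its initial value bounds the
probability that phase `I` misses the target (`measure_phase_avoids_target_le`). A play that
eventually avoids the target misses all late phases, so letting `I` tend to infinity bounds the
failure by ε (`one_sub_le_playMeasure_riskStrategy`). Both games are treated at once through a map
`κ` to `BadState` that respects `Moves`. -/

namespace StochGame

/-! ### Histories read off plays -/

section Plays

variable {S A B : Type}

theorem Play.hist_congr {ω ω' : Play S A B} {n : ℕ} (h : ∀ k ≤ n, ω k = ω' k) :
    ω.hist n = ω'.hist n := by
  induction n with
  | zero => simp [Play.hist, h 0 le_rfl]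
  | succ n ih =>
    simp only [Play.hist, ih fun k hk => h k (hk.trans n.le_succ), h n n.le_succ, h _ le_rfl]

theorem histOfPrefix_frestrictLe (ω : Play S A B) (n : ℕ) :
    histOfPrefix n (Preorder.frestrictLe n ω) = ω.hist n :=
  Play.hist_congr fun k hk => by
    simp [Preorder.frestrictLe, min_eq_left hk]

theorem Play.last_hist (ω : Play S A B) (n : ℕ) : (ω.hist n).last = (ω n).1 := by
  cases n <;> rfl

theorem Play.len_hist (ω : Play S A B) (n : ℕ) : (ω.hist n).len = n := by
  induction n with
  | zero => rfl
  | succ n ih => simp [Play.hist, History.len, ih]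

theorem Play.visited_hist (ω : Play S A B) (x : S) (k n : ℕ) :
    (ω.hist n).Visited x k ↔ ∃ j, k ≤ j ∧ j ≤ n ∧ (ω j).1 = x := by
  induction n with
  | zero =>
    simp only [Play.hist, History.Visited]
    constructor
    · rintro ⟨h, rfl⟩
      exact ⟨0, h, le_rfl, rfl⟩
    · rintro ⟨j, h, hj, rfl⟩
      obtain rfl : j = 0 := by omega
      exact ⟨h, rfl⟩
  | succ n ih =>
    simp only [Play.hist, History.Visited, ih, Play.len_hist]
    constructor
    · rintro (⟨j, h, hj, e⟩ | ⟨h, e⟩)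
      · exact ⟨j, h, by omega, e⟩
      · exact ⟨n + 1, h, le_rfl, e⟩
    · rintro ⟨j, h, hj, e⟩
      rcases Nat.lt_or_ge n j with hn | hn
      · obtain rfl : j = n + 1 := by omega
        exact .inr ⟨h, e⟩
      · exact .inl ⟨j, h, hn, e⟩

end Plays

/-! ### Integration against the measure on plays -/

section Measure

variable {S A B : Type} [Fintype S] [Fintype A] [Fintype B]
  [MeasurableSpace S] [MeasurableSpace A] [MeasurableSpace B]
  [DiscreteMeasurableSpace S] [DiscreteMeasurableSpace A] [DiscreteMeasurableSpace B]

theorem lintegral_stepPMF (σ : MaxStrategy S A B) (π : MinStrategy S A B) (h : History S A B)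
    (f : S × A × B → ℝ≥0∞) :
    ∫⁻ y, f y ∂(stepPMF σ π h).toMeasure =
      ∑ a, ∑ b, σ h a * π h b * f (h.last, a, b) := by
  classical
  have key : ∀ y : S × A × B, stepPMF σ π h y =
      if y.1 = h.last then σ h y.2.1 * π h y.2.2 else 0 := by
    rintro ⟨s, a, b⟩
    simp only [stepPMF, PMF.bind_apply, tsum_fintype, PMF.pure_apply, Prod.mk.injEq, mul_ite,
      mul_one, mul_zero]
    split_ifs with hs
    · rw [Finset.sum_eq_single a, Finset.sum_eq_single b]
      · simp [hs]
      · intro b' _ hb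
        simp [hb.symm]
      · simp
      · intro a' _ ha
        simp [ha.symm]
      · simp
    · simp [hs]
  rw [lintegral_fintype]
  simp_rw [PMF.toMeasure_apply_singleton _ _ (MeasurableSet.singleton _), key]
  rw [Fintype.sum_prod_type, Finset.sum_eq_single h.last]
  · rw [Fintype.sum_prod_type]
    simp [mul_comm]
  · intro s _ hs
    simp [hs]
  · simp

instance (G : Game S A B) (s₀ : S) (σ : MaxStrategy S A B) (π : MinStrategy S A B) :
    IsProbabilityMeasure (playMeasure G s₀ σ π) := by
  unfold playMeasure
  infer_instance

theorem lintegral_playMeasure_zero (G : Game S A B) (s₀ : S) (σ : MaxStrategy S A B)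
    (π : MinStrategy S A B) (f : S × A × B → ℝ≥0∞) :
    ∫⁻ ω, f (ω 0) ∂(playMeasure G s₀ σ π) =
      ∫⁻ y, f y ∂(stepPMF σ π (.init s₀)).toMeasure := by
  have hf : Measurable f := .of_discrete
  have h1 : (playMeasure G s₀ σ π).map (Preorder.frestrictLe (π := fun _ => S × A × B) 0) =
      (stepPMF σ π (.init s₀)).toMeasure.map
        (MeasurableEquiv.piUnique (fun _ : Finset.Iic 0 => S × A × B)).symm := by
    rw [playMeasure, Kernel.trajMeasure, Measure.map_comp _ _ (by fun_prop),
      Kernel.traj_map_frestrictLe, Kernel.partialTraj_self, Measure.id_comp]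
  have h2 := congrArg (fun μ => ∫⁻ x, f (x ⟨0, Finset.mem_Iic.2 le_rfl⟩) ∂μ) h1
  rw [lintegral_map (by fun_prop) (by fun_prop), lintegral_map (by fun_prop) (by fun_prop)] at h2
  exact h2

/-- Tower property: condition on the first `n + 1` entries. The actions of step `n` are separate
arguments of `F` because `ω.hist n` stops at the state of step `n`. -/
theorem lintegral_playMeasure_succ (G : Game S A B) (s₀ : S) (σ : MaxStrategy S A B)
    (π : MinStrategy S A B) (n : ℕ) (F : History S A B → A → B → S × A × B → ℝ≥0∞) :
    ∫⁻ ω, F (ω.hist n) (ω n).2.1 (ω n).2.2 (ω (n + 1)) ∂(playMeasure G s₀ σ π) =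
      ∫⁻ ω, ∫⁻ y, F (ω.hist n) (ω n).2.1 (ω n).2.2 y
        ∂(nextPMF G σ π (ω.hist n) (ω n).2.1 (ω n).2.2).toMeasure ∂(playMeasure G s₀ σ π) := by
  have h1 := Kernel.map_frestrictLe_trajMeasure_compProd_eq_map_trajMeasure
    (X := fun _ => S × A × B) (μ₀ := (stepPMF σ π (.init s₀)).toMeasure)
    (κ := playKernel G σ π) (a := n)
  let Φ : (Finset.Iic n → S × A × B) × (S × A × B) → ℝ≥0∞ := fun z =>
    F (histOfPrefix n z.1) (z.1 ⟨n, Finset.mem_Iic.2 le_rfl⟩).2.1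
      (z.1 ⟨n, Finset.mem_Iic.2 le_rfl⟩).2.2 z.2
  have hΦ : Measurable Φ := measurable_of_countable _
  have h2 := congrArg (fun μ => ∫⁻ z, Φ z ∂μ) h1
  rw [lintegral_map hΦ (by fun_prop), Measure.lintegral_compProd hΦ,
    lintegral_map (measurable_of_countable _) (by fun_prop)] at h2
  simp only [Φ, histOfPrefix_frestrictLe] at h2
  refine h2.symm.trans (lintegral_congr fun ω => ?_)
  simp only [playKernel, Kernel.ofFunOfCountable, Kernel.coe_mk, histOfPrefix_frestrictLe]
  rfl

/-- A function of histories that does not increase on average, at the first `n + 1` steps of a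
game with deterministic transitions, has at step `n + 1` at most its initial value on average. -/
theorem lintegral_hist_le_of_supermartingale (G : Game S A B) (next : S → A → B → S)
    (hG : ∀ s a b, G.trans s a b = PMF.pure (next s a b)) (s₀ : S) (σ : MaxStrategy S A B)
    (π : MinStrategy S A B) (V : History S A B → ℝ≥0∞) (N : ℕ)
    (hV : ∀ h : History S A B, h.len < N + 1 →
      ∑ a, ∑ b, σ h a * π h b * V (h.step a b (next h.last a b)) ≤ V h) :
    ∫⁻ ω, V (ω.hist (N + 1)) ∂(playMeasure G s₀ σ π) ≤ V (.init s₀) := by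
  have hnext : ∀ h a b, nextPMF G σ π h a b = stepPMF σ π (h.step a b (next h.last a b)) := by
    intro h a b
    rw [nextPMF, hG, PMF.pure_bind]
  have hsum : ∀ (h : History S A B) (c : ℝ≥0∞), ∑ a, ∑ b, σ h a * π h b * c = c := by
    intro h c
    have hσ := (σ h).tsum_coe
    have hπ := (π h).tsum_coe
    rw [tsum_fintype] at hσ hπ
    simp_rw [← Finset.sum_mul, ← Finset.mul_sum, hπ, mul_one, hσ, one_mul]
  -- Entry `n` already contains the actions of step `n`, which determine the next state. Phrased
  -- this way, each induction step averages over a single draw of actions.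
  have hpre : ∀ n ≤ N, ∫⁻ ω, V ((ω.hist n).step (ω n).2.1 (ω n).2.2
      (next (ω.hist n).last (ω n).2.1 (ω n).2.2)) ∂(playMeasure G s₀ σ π) ≤ V (.init s₀) := by
    intro n
    induction n with
    | zero =>
      intro _
      refine le_trans (le_of_eq ?_) (hV (.init s₀) (Nat.succ_pos N))
      have := lintegral_playMeasure_zero G s₀ σ π
        (fun y => V ((History.init y.1).step y.2.1 y.2.2 (next y.1 y.2.1 y.2.2)))
      rw [lintegral_stepPMF] at this
      exact this
    | succ n ih =>
      intro hn
      refine le_trans ?_ (ih (by omega))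
      have := lintegral_playMeasure_succ G s₀ σ π n (fun h a b y =>
        V ((h.step a b y.1).step y.2.1 y.2.2 (next y.1 y.2.1 y.2.2)))
      refine (le_of_eq this).trans (lintegral_mono fun ω => ?_)
      rw [hnext, lintegral_stepPMF]
      exact hV ((ω.hist n).step _ _ _) (by simp [History.len, Play.len_hist]; omega)
  -- The actions drawn at step `N + 1` do not enter `V` and integrate out by `hsum`.
  refine le_trans (le_of_eq ?_) (hpre N le_rfl)
  refine (lintegral_playMeasure_succ G s₀ σ π N (fun h a b y => V (h.step a b y.1))).trans
    (lintegral_congr fun ω => ?_)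
  rw [hnext, lintegral_stepPMF]
  exact hsum _ (V ((ω.hist N).step _ _ (next (ω.hist N).last _ _)))

end Measure

/-! ### Phases and the one-bit strategy -/

/-- The first step of phase `i`. -/
def phaseStart (i : ℕ) : ℕ := 4 ^ i - 1

/-- The phase of step `n`. -/
def phase (n : ℕ) : ℕ := Nat.log 4 (n + 1)

theorem phaseStart_add_one (i : ℕ) : phaseStart i + 1 = 4 ^ i :=
  Nat.sub_add_cancel (Nat.one_le_pow _ _ (by norm_num))

theorem phaseStart_strictMono : StrictMono phaseStart := fun i j h => by
  have := phaseStart_add_one i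
  have := phaseStart_add_one j
  have := Nat.pow_lt_pow_right (a := 4) (by norm_num) h
  omega

theorem phase_eq_iff {i n : ℕ} : phase n = i ↔ phaseStart i ≤ n ∧ n < phaseStart (i + 1) := by
  have := phaseStart_add_one i
  have := phaseStart_add_one (i + 1)
  rw [phase, Nat.log_eq_iff (.inr ⟨by norm_num, by omega⟩)]
  omega

theorem phase_zero : phase 0 = 0 := by simp [phase]

theorem phase_succ (n : ℕ) : phase (n + 1) = phase n ∨
    (phase (n + 1) = phase n + 1 ∧ n + 1 = phaseStart (phase n + 1)) := by
  obtain ⟨h1, h2⟩ := phase_eq_iff.1 (rfl : phase n = phase n)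
  rcases Nat.lt_or_ge (n + 1) (phaseStart (phase n + 1)) with h | h
  · exact .inl (phase_eq_iff.2 ⟨by omega, h⟩)
  · have e : n + 1 = phaseStart (phase n + 1) := by omega
    exact .inr ⟨phase_eq_iff.2 ⟨h, e ▸ phaseStart_strictMono (Nat.lt_succ_self _)⟩, e⟩

theorem History.Visited.le_len {S A B : Type} {x : S} {k : ℕ} {h : History S A B}
    (hv : h.Visited x k) : k ≤ h.len := by
  induction h with
  | init s => exact hv.1
  | step h a b s ih =>
    rcases hv with hv | hv
    · exact (ih hv).trans (Nat.le_succ _)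
    · exact hv.1

/-- The strategy that records in its bit whether `x` was visited in the current phase, plays `0`
once this is the case, and plays `α i` in phase `i` before. -/
noncomputable def phaseStrategy {S : Type} [DecidableEq S] (x : S) (α : ℕ → PMF (Fin 2)) :
    MemoryStrategy S (Fin 2) (Fin 2) (ℕ × Bool) where
  initMode := (0, false)
  act m _ := if m.2 = true then PMF.pure 0 else α (phase m.1)
  update _ m _ _ s := (m.1 + 1, (m.2 && decide (phase (m.1 + 1) = phase m.1)) || decide (s = x))

section PhaseStrategy

variable {S : Type} [DecidableEq S] (x : S) (α : ℕ → PMF (Fin 2))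

theorem phaseStrategy_isOneBitMarkov : (phaseStrategy x α).IsOneBitMarkov := by
  intro h
  induction h with
  | init s => rfl
  | step h a b s ih => exact congrArg (· + 1) ih

theorem phaseStrategy_bit_step (h : History S (Fin 2) (Fin 2)) (a b : Fin 2) (s : S) :
    ((phaseStrategy x α).mode (h.step a b s)).2 =
      ((((phaseStrategy x α).mode h).2 && decide (phase (h.len + 1) = phase h.len)) ||
        decide (s = x)) := by
  rw [← phaseStrategy_isOneBitMarkov x α h]
  rfl

theorem phaseStrategy_apply (h : History S (Fin 2) (Fin 2)) :
    (phaseStrategy x α).toStrategy h =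
      if ((phaseStrategy x α).mode h).2 = true then PMF.pure 0 else α (phase h.len) := by
  rw [← phaseStrategy_isOneBitMarkov x α h]
  rfl

/-- The extra disjunct is needed because the initial bit is `false` even for a history that starts
at `x`. -/
theorem phaseStrategy_bit_or_iff (h : History S (Fin 2) (Fin 2)) :
    (((phaseStrategy x α).mode h).2 = true ∨ (h.first = x ∧ phase h.len = 0)) ↔
      h.Visited x (phaseStart (phase h.len)) := by
  induction h with
  | init s =>
    change (false = true ∨ (s = x ∧ phase 0 = 0)) ↔ (phaseStart (phase 0) ≤ 0 ∧ s = x)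
    simp [phase_zero, phaseStart]
  | step h a b s ih =>
    rw [phaseStrategy_bit_step]
    simp only [Bool.or_eq_true, Bool.and_eq_true, decide_eq_true_eq, History.Visited,
      History.len, History.first]
    have hle := (phase_eq_iff.1 (rfl : phase (h.len + 1) = _)).1
    rcases phase_succ h.len with e | ⟨e, e'⟩
    · simp only [e] at hle ⊢
      simp only [← ih, hle, true_and, and_true]
      tauto
    -- A new phase begins: only the new state can count as a visit.
    · have h1 : ¬ h.Visited x (h.len + 1) := fun hv => by
        have := hv.le_len
        omega
      simp [e, h1, ← e']

theorem phaseStrategy_playsInPhases {d : S} (hd : d ≠ x) :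
    (phaseStrategy x α).PlaysInPhases d x 0 := by
  refine ⟨phaseStart, α, rfl, phaseStart_strictMono, fun i h hf h1 h2 => ?_⟩
  have hi := phase_eq_iff.2 ⟨h1, h2⟩
  refine ⟨?_, fun _ => ?_⟩
  · rw [← hi, ← phaseStrategy_bit_or_iff x α h, hf]
    simp [hd]
  · rw [phaseStrategy_apply, hi]

end PhaseStrategy

/-! ### The potential and its supermartingale inequality -/

/-- `Moves k k₀ k₁`: from `k`, for some action of Min, the action `i` of Max leads to `kᵢ`, in the
Bad Match or in the Simplified Bad Match. -/
inductive Moves : BadState → BadState → BadState → Prop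
  | lose : Moves .l .l .l
  | win : Moves .w .w .w
  | back_s : Moves .s .d .d
  | back_t : Moves .t .d .d
  | zero : Moves .d .s .l
  | one_w : Moves .d .t .w
  | one_s : Moves .d .t .s

/-- The probability of the action `1` in phase `i`. -/
noncomputable def risk (ε : ℝ) (i : ℕ) : ℝ := ε / 2 ^ (i + 1)

/-- The number `0` at `w`, `1` at `l`, `x` at `d` and `y` elsewhere. -/
def stateBound (x y : ℝ) : BadState → ℝ
  | .w => 0
  | .l => 1
  | .d => x
  | .s => y
  | .t => y

/-- A bound on the probability that phase `I` has no visit to the target set, given that the play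
is at a state of the kind `k` at step `n ≤` the end of phase `I`, with the bit `b`. -/
noncomputable def failBound (ε : ℝ) (I n : ℕ) (b : Bool) (k : BadState) : ℝ :=
  if phase n < I then
    -- Before phase `I`: the sum of the risks still to be taken, where a set bit spares that of the
    -- current phase, plus the probability that all trials of phase `I` fail.
    stateBound (ε / 2 ^ (if b = true then phase n + 1 else phase n) + (1 - risk ε I) ^ 4 ^ I)
      (ε / 2 ^ (if b = true then phase n + 1 else phase n) + (1 - risk ε I) ^ 4 ^ I) k
  else if b = true then 0
  else
    -- In phase `I`: one possible loss, plus the failure of all remaining trials. A trial takes two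
    -- steps, and its outcome must be seen before the phase ends; away from `d` one step is spent on
    -- returning.
    stateBound (risk ε I + (1 - risk ε I) ^ ((phaseStart (I + 1) - n) / 2))
      (risk ε I + (1 - risk ε I) ^ ((phaseStart (I + 1) - n - 1) / 2)) k

theorem risk_pos {ε : ℝ} (h0 : 0 < ε) (i : ℕ) : 0 < risk ε i := by
  unfold risk
  positivity

theorem risk_le_one {ε : ℝ} (h1 : ε ≤ 1) (i : ℕ) : risk ε i ≤ 1 := by
  unfold risk
  rw [div_le_one (by positivity)]
  exact h1.trans (one_le_pow₀ (by norm_num))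

/-- The second summand is the total risk of all phases after `i`. -/
theorem risk_add (ε : ℝ) (i : ℕ) : risk ε i + ε / 2 ^ (i + 1) = ε / 2 ^ i := by
  unfold risk
  rw [pow_succ]
  field_simp
  norm_num

theorem failBound_win (ε : ℝ) (I n : ℕ) (b : Bool) : failBound ε I n b .w = 0 := by
  simp [failBound, stateBound]

theorem failBound_lose_le_one (ε : ℝ) (I n : ℕ) (b : Bool) : failBound ε I n b .l ≤ 1 := by
  simp only [failBound, stateBound]
  split_ifs <;> norm_num

theorem failBound_nonneg {ε : ℝ} (h0 : 0 < ε) (h1 : ε ≤ 1) (I n : ℕ) (b : Bool) (k : BadState) :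
    0 ≤ failBound ε I n b k := by
  have hr := (risk_pos h0 I).le
  have hq : 0 ≤ 1 - risk ε I := sub_nonneg.2 (risk_le_one h1 I)
  unfold failBound
  unfold stateBound
  split_ifs <;> cases k <;> positivity

/-- A phase begins with the full remaining budget, whatever the bit. For phase `I` itself this uses
that its 3·4^I steps leave room for 4^I trials, even after one step of return to `d`. -/
theorem failBound_phaseStart_le {ε : ℝ} (h0 : 0 < ε) (h1 : ε ≤ 1) {I n : ℕ} (b : Bool)
    {k : BadState} (hk : k ≠ .l) (hn : n = phaseStart (phase n)) (hI : phase n ≤ I) :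
    failBound ε I n b k ≤ ε / 2 ^ phase n + (1 - risk ε I) ^ 4 ^ I := by
  have hr := (risk_pos h0 I).le
  have hq : 0 ≤ 1 - risk ε I := sub_nonneg.2 (risk_le_one h1 I)
  have hc : 0 ≤ (1 - risk ε I) ^ 4 ^ I := by positivity
  have hle : ε / 2 ^ (phase n + 1) ≤ ε / 2 ^ phase n := by
    have := risk_add ε (phase n)
    have := (risk_pos h0 (phase n)).le
    linarith
  have hp : 0 ≤ ε / 2 ^ phase n := by positivity
  unfold failBound
  split_ifs with hlt hb hb
  · cases k <;> simp only [stateBound] at hk ⊢ <;> first | contradiction | linarith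
  · cases k <;> simp only [stateBound] at hk ⊢ <;> first | contradiction | linarith
  · linarith
  · have e : phase n = I := by omega
    rw [e] at hn hp ⊢
    have hrI : risk ε I ≤ ε / 2 ^ I := by
      have := risk_add ε I
      have : 0 ≤ ε / 2 ^ (I + 1) := by positivity
      linarith
    have hm : ∀ m, 4 ^ I ≤ m → (1 - risk ε I) ^ m ≤ (1 - risk ε I) ^ 4 ^ I := fun m hm =>
      pow_le_pow_of_le_one hq (by linarith) hm
    have e1 := phaseStart_add_one I
    have e2 := phaseStart_add_one (I + 1)
    have e3 : 4 ^ (I + 1) = 4 * 4 ^ I := by ring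
    have e4 : 1 ≤ 4 ^ I := Nat.one_le_pow _ _ (by norm_num)
    have m1 := hm ((phaseStart (I + 1) - n) / 2) (by omega)
    have m2 := hm ((phaseStart (I + 1) - n - 1) / 2) (by omega)
    cases k <;> simp only [stateBound] at hk ⊢ <;> first | contradiction | linarith

/-- Crossing a phase boundary may clear the bit, but the next phase's full budget is what a set bit
left over, so nothing is lost. -/
theorem failBound_succ_le {ε : ℝ} (h0 : 0 < ε) (h1 : ε ≤ 1) {I n : ℕ} (b : Bool)
    {k : BadState} (hk : k ≠ .l) (hI : phase n < I) :
    failBound ε I (n + 1) ((b && decide (phase (n + 1) = phase n)) || decide (k = .s)) k ≤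
      ε / 2 ^ (if (b || decide (k = .s)) = true then phase n + 1 else phase n) +
        (1 - risk ε I) ^ 4 ^ I := by
  have hq : 0 ≤ 1 - risk ε I := sub_nonneg.2 (risk_le_one h1 I)
  rcases phase_succ n with e | ⟨e, e'⟩
  · rw [e, decide_eq_true rfl, Bool.and_true]
    unfold failBound
    rw [if_pos (e ▸ hI), e]
    cases k <;> simp only [stateBound] at hk ⊢ <;> first | contradiction | rfl | positivity
  · refine (failBound_phaseStart_le h0 h1 _ hk (e ▸ e') (by omega)).trans ?_
    rw [e]
    have := risk_add ε (phase n)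
    have := (risk_pos h0 (phase n)).le
    split_ifs <;> linarith

/-- The bound `failBound` does not increase on average. -/
theorem failBound_step {ε : ℝ} (h0 : 0 < ε) (h1 : ε ≤ 1) {I n : ℕ} (hI : phase (n + 1) ≤ I)
    (b : Bool) {k k₀ k₁ : BadState} (hm : Moves k k₀ k₁) {p : ℝ}
    (hp : p = if b = true then 0 else risk ε (phase n)) :
    (1 - p) * failBound ε I (n + 1)
          ((b && decide (phase (n + 1) = phase n)) || decide (k₀ = .s)) k₀ +
        p * failBound ε I (n + 1)
          ((b && decide (phase (n + 1) = phase n)) || decide (k₁ = .s)) k₁ ≤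
      failBound ε I n b k := by
  have hq : 0 ≤ 1 - risk ε I := sub_nonneg.2 (risk_le_one h1 I)
  have hrI := (risk_pos h0 I).le
  have hmono : phase n ≤ phase (n + 1) := by
    rcases phase_succ n with e | ⟨e, -⟩ <;> omega
  rcases (hmono.trans hI).lt_or_eq with hlt | heq
  · have hj := risk_add ε (phase n)
    have hr0 := (risk_pos h0 (phase n)).le
    have hr1 := risk_le_one h1 (phase n)
    have hc : 0 ≤ (1 - risk ε I) ^ 4 ^ I := by positivity
    have hp0 : 0 ≤ ε / 2 ^ (phase n + 1) := by positivity
    have hd := failBound_succ_le h0 h1 b (k := .d) (by simp) hlt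
    have hs := failBound_succ_le h0 h1 b (k := .s) (by simp) hlt
    have ht := failBound_succ_le h0 h1 b (k := .t) (by simp) hlt
    have hl : failBound ε I (n + 1)
        ((b && decide (phase (n + 1) = phase n)) || decide (BadState.l = .s)) .l ≤ 1 :=
      failBound_lose_le_one _ _ _ _
    have hlose : ∀ b, failBound ε I n b .l = 1 := fun b => by
      simp only [failBound, stateBound, if_pos hlt]
    have hval : ∀ b k, k ≠ .l → k ≠ .w → failBound ε I n b k =
        ε / 2 ^ (if b = true then phase n + 1 else phase n) + (1 - risk ε I) ^ 4 ^ I := by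
      intro b k hl hw
      simp only [failBound, if_pos hlt]
      cases k <;> first | contradiction | rfl
    subst hp
    cases hm
    case lose => rw [hlose]; linarith
    case win => simp only [failBound_win]; linarith
    case back_s =>
      rw [hval _ _ (by simp) (by simp)]
      simp only [reduceCtorEq, decide_false, Bool.or_false] at hd ⊢
      linarith
    case back_t =>
      rw [hval _ _ (by simp) (by simp)]
      simp only [reduceCtorEq, decide_false, Bool.or_false] at hd ⊢
      linarith
    -- Moves from `d`. The tight case is a clear bit with Min playing 0: the risk of loss is paid
    -- for by setting the bit at `s`, as in `risk_add`.
    all_goals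
      rw [hval _ _ (by simp) (by simp)]
      try rw [failBound_win]
      cases b <;>
        simp only [reduceCtorEq, decide_false, decide_true, Bool.or_false, Bool.or_true,
          Bool.false_and, Bool.true_and, if_true, if_false, Bool.false_eq_true] at hd hs ht hl ⊢ <;>
        nlinarith
  · have e : phase (n + 1) = I := by omega
    rw [e, heq, decide_eq_true rfl, Bool.and_true]
    have h2 := (phase_eq_iff.1 e).2
    simp only [failBound, e, heq, lt_irrefl, if_false]
    cases b
    case true => simp
    case false =>
      simp only [heq, Bool.false_eq_true, if_false] at hp
      subst hp
      have hpow : 0 ≤ (1 - risk ε I) ^ ((phaseStart (I + 1) - n) / 2) := by positivity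
      -- One trial of phase `I` is used up when Min plays 1; when Min plays 0, the summand `risk ε
      -- I` covers the loss, since `s` has potential 0.
      have hstep : (1 - risk ε I) * (1 - risk ε I) ^ ((phaseStart (I + 1) - (n + 1) - 1) / 2) ≤
          (1 - risk ε I) ^ ((phaseStart (I + 1) - n) / 2) := by
        rw [← pow_succ']
        exact pow_le_pow_of_le_one hq (by linarith) (by omega)
      rw [Nat.sub_add_eq] at hstep
      cases hm <;> simp [stateBound, Nat.sub_add_eq] <;> nlinarith

/-! ### From the potential to the value -/

/-- The distribution on the actions that gives the action `1` the probability `p`. -/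
noncomputable def mixedAction (p : ℝ) (h0 : 0 ≤ p) (h1 : p ≤ 1) : PMF (Fin 2) :=
  PMF.ofFintype ![ENNReal.ofReal (1 - p), ENNReal.ofReal p] (by
    rw [Fin.sum_univ_two]
    simp [← ENNReal.ofReal_add (sub_nonneg.2 h1) h0])

/-- The number of trials outgrows the inverse risk: 4^I · r_I = (ε/2) · 2^I, and 1 - r ≤ exp(-r). -/
theorem tendsto_one_sub_risk_pow {ε : ℝ} (h0 : 0 < ε) (h1 : ε ≤ 1) :
    Tendsto (fun I => (1 - risk ε I) ^ 4 ^ I) atTop (nhds 0) := by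
  have hlim : Tendsto (fun I : ℕ => Real.exp (-(ε / 2 * 2 ^ I))) atTop (nhds 0) :=
    Real.tendsto_exp_neg_atTop_nhds_zero.comp
      ((tendsto_pow_atTop_atTop_of_one_lt (by norm_num)).const_mul_atTop (by positivity))
  refine squeeze_zero (fun I => pow_nonneg (sub_nonneg.2 (risk_le_one h1 I)) _) (fun I => ?_) hlim
  refine (pow_le_pow_left₀ (sub_nonneg.2 (risk_le_one h1 I))
    (Real.one_sub_le_exp_neg (risk ε I)) _).trans (le_of_eq ?_)
  rw [← Real.exp_nat_mul]
  congr 1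
  have : (4 : ℝ) ^ I = 2 ^ I * 2 ^ I := by rw [← mul_pow]; norm_num
  rw [risk, Nat.cast_pow, Nat.cast_ofNat, this, pow_succ]
  field_simp

theorem measurable_hist_apply {S : Type} [Fintype S] [MeasurableSpace S]
    [DiscreteMeasurableSpace S] (V : History S (Fin 2) (Fin 2) → ℝ≥0∞) (n : ℕ) :
    Measurable fun ω : Play S (Fin 2) (Fin 2) => V (ω.hist n) := by
  have h : Measurable fun x : Finset.Iic n → S × Fin 2 × Fin 2 => V (histOfPrefix n x) :=
    measurable_of_countable _
  have := h.comp (Preorder.measurable_frestrictLe (X := fun _ => S × Fin 2 × Fin 2) n)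
  simpa only [Function.comp_def, histOfPrefix_frestrictLe] using this

section Guarantee

variable {S : Type} [Fintype S] [DecidableEq S] [MeasurableSpace S] [DiscreteMeasurableSpace S]

variable (G : Game S (Fin 2) (Fin 2)) (next : S → Fin 2 → Fin 2 → S)
  (hG : ∀ x a b, G.trans x a b = PMF.pure (next x a b)) (κ : S → BadState) (d s : S)
  (hd : κ d = .d) (hs : ∀ x, x = s ↔ κ x = .s)
  (hmoves : ∀ x b, Moves (κ x) (κ (next x 0 b)) (κ (next x 1 b)))
  {ε : ℝ} (h0 : 0 < ε) (h1 : ε ≤ 1) (π : MinStrategy S (Fin 2) (Fin 2))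

/-- The strategy that plays in phases and takes the risk `risk ε i` in phase `i`. -/
noncomputable def riskStrategy (s : S) {ε : ℝ} (h0 : 0 < ε) (h1 : ε ≤ 1) :
    MemoryStrategy S (Fin 2) (Fin 2) (ℕ × Bool) :=
  phaseStrategy s fun i => mixedAction (risk ε i) (risk_pos h0 i).le (risk_le_one h1 i)

include hG hd hs hmoves in
theorem measure_phase_avoids_target_le (I : ℕ) :
    playMeasure G d (riskStrategy s h0 h1).toStrategy π
        {ω | ∀ n, phase n = I → ¬ (κ (ω n).1 = .w ∨ κ (ω n).1 = .s)} ≤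
      ENNReal.ofReal (ε + (1 - risk ε I) ^ 4 ^ I) := by
  let bit : History S (Fin 2) (Fin 2) → Bool := fun h => ((riskStrategy s h0 h1).mode h).2
  let V : History S (Fin 2) (Fin 2) → ℝ≥0∞ := fun h =>
    ENNReal.ofReal (failBound ε I h.len (bit h) (κ h.last))
  -- `N + 1` is the last step of phase `I`.
  obtain ⟨N, hN⟩ : ∃ N, phaseStart (I + 1) = N + 2 := by
    have := phaseStart_add_one (I + 1)
    have : 4 ^ 1 ≤ 4 ^ (I + 1) := Nat.pow_le_pow_right (by norm_num) (by omega)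
    exact ⟨phaseStart (I + 1) - 2, by omega⟩
  have hlast : phase (N + 1) = I := by
    have := phaseStart_strictMono (Nat.lt_succ_self I)
    exact phase_eq_iff.2 ⟨by simp at this; omega, by omega⟩
  have hphase : ∀ n, n ≤ N + 1 → phase n ≤ I := fun n hn => by
    rw [← hlast]
    exact Nat.log_mono_right (by omega)
  have hV : ∀ h : History S (Fin 2) (Fin 2), h.len < N + 1 →
      ∑ a, ∑ b, (riskStrategy s h0 h1).toStrategy h a * π h b *
        V (h.step a b (next h.last a b)) ≤ V h := by
    intro h hlen
    -- The inequality holds for each pure action of Min, hence for every mixture.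
    rw [Finset.sum_comm]
    have hπ := (π h).tsum_coe
    rw [tsum_fintype] at hπ
    calc _ ≤ ∑ b, π h b * V h := Finset.sum_le_sum fun b _ => ?_
      _ = V h := by rw [← Finset.sum_mul, hπ, one_mul]
    rw [Fin.sum_univ_two]
    have hb : ∀ a, bit (h.step a b (next h.last a b)) =
        ((bit h && decide (phase (h.len + 1) = phase h.len)) ||
          decide (κ (next h.last a b) = .s)) := fun a => by
      rw [← decide_eq_decide.2 (hs _)]
      exact phaseStrategy_bit_step _ _ _ _ _ _
    obtain ⟨p, hp, hp0, hp1, e0, e1⟩ : ∃ p : ℝ,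
        (p = if bit h = true then 0 else risk ε (phase h.len)) ∧ 0 ≤ p ∧ p ≤ 1 ∧
        (riskStrategy s h0 h1).toStrategy h 0 = ENNReal.ofReal (1 - p) ∧
        (riskStrategy s h0 h1).toStrategy h 1 = ENNReal.ofReal p := by
      rw [riskStrategy, phaseStrategy_apply]
      change ∃ p : ℝ, _ ∧ _ ∧ _ ∧ (if bit h = true then _ else _ : PMF (Fin 2)) _ = _ ∧
        (if bit h = true then _ else _ : PMF (Fin 2)) _ = _
      by_cases hbit : bit h = true
      · exact ⟨0, by simp [hbit], le_rfl, zero_le_one, by simp [hbit], by simp [hbit]⟩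
      · simp only [hbit]
        exact ⟨_, rfl, (risk_pos h0 _).le, risk_le_one h1 _, rfl, rfl⟩
    have hstep := failBound_step h0 h1 (hphase (h.len + 1) (by omega)) (bit h)
      (hmoves h.last b) hp
    have hnn := fun n b k => failBound_nonneg h0 h1 I n b k
    calc _ = π h b * (ENNReal.ofReal (1 - p) * V (h.step 0 b (next h.last 0 b)) +
          ENNReal.ofReal p * V (h.step 1 b (next h.last 1 b))) := by
          rw [e0, e1]
          ring
      _ ≤ π h b * V h := by
          gcongr
          simp only [V, hb]
          rw [← ENNReal.ofReal_mul (sub_nonneg.2 hp1), ← ENNReal.ofReal_mul hp0,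
            ← ENNReal.ofReal_add (mul_nonneg (sub_nonneg.2 hp1) (hnn _ _ _))
              (mul_nonneg hp0 (hnn _ _ _))]
          exact ENNReal.ofReal_le_ofReal hstep
  have hsuper := lintegral_hist_le_of_supermartingale G next hG d
    (riskStrategy s h0 h1).toStrategy π V N hV
  -- Markov's inequality: if phase `I` misses the target, the potential at its last step is at least
  -- 1.
  refine (meas_le_lintegral₀ (measurable_hist_apply V (N + 1)).aemeasurable ?_).trans
    (hsuper.trans (ENNReal.ofReal_le_ofReal ?_))
  · intro ω hω
    have hω' : ∀ n, phase n = I → ¬ (κ (ω n).1 = .w ∨ κ (ω n).1 = .s) := hω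
    have hbit : bit (ω.hist (N + 1)) = false := by
      by_contra hb
      have hv := (phaseStrategy_bit_or_iff s _ (ω.hist (N + 1))).1
        (.inl (Bool.eq_true_of_not_eq_false hb))
      rw [Play.len_hist, hlast, Play.visited_hist] at hv
      obtain ⟨j, hj, hjN, hjs⟩ := hv
      exact hω' j (phase_eq_iff.2 ⟨hj, by omega⟩) (.inr ((hs _).1 hjs))
    have hfinal := hω' (N + 1) hlast
    simp only [V, hbit, Play.len_hist, Play.last_hist, ENNReal.one_le_ofReal, failBound, hlast,
      lt_irrefl, if_false, Bool.false_eq_true, hN]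
    -- No trials remain, so both powers equal 1.
    have e1 : (N + 2 - (N + 1)) / 2 = 0 := by omega
    have e2 : (N + 2 - (N + 1) - 1) / 2 = 0 := by omega
    have hr := (risk_pos h0 I).le
    rw [e1, e2]
    cases hκ : κ (ω (N + 1)).1 <;> simp [hκ, stateBound, hr] at hfinal ⊢
  · have := failBound_phaseStart_le h0 h1 (I := I) (n := 0) false (k := .d) (by simp)
      (by rw [phase_zero]; rfl) (by rw [phase_zero]; omega)
    rw [phase_zero, pow_zero, div_one, ← hd] at this
    exact this

include hG hd hs hmoves in
-- Failure is the increasing union of the events `D m` that the target is avoided from step `m` on.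
-- Each `D m` lies in the failure event of every phase `I ≥ m`, whose bound tends to ε.
theorem one_sub_le_playMeasure_riskStrategy :
    1 - ENNReal.ofReal ε ≤ playMeasure G d (riskStrategy s h0 h1).toStrategy π
      (buchi (Fin 2) (Fin 2) {x | κ x = .w ∨ κ x = .s}) := by
  set μ := playMeasure G d (riskStrategy s h0 h1).toStrategy π
  set E := buchi (Fin 2) (Fin 2) {x | κ x = .w ∨ κ x = .s}
  let D : ℕ → Set (Play S (Fin 2) (Fin 2)) := fun m =>
    {ω | ∀ n, m ≤ n → ¬ (κ (ω n).1 = .w ∨ κ (ω n).1 = .s)}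
  have hE : Eᶜ = ⋃ m, D m := by
    ext ω
    simp only [E, D, buchi, Set.mem_compl_iff, Set.mem_ofPred_eq, Filter.not_frequently,
      Filter.eventually_atTop, Set.mem_iUnion]
  have hD : Monotone D := fun m m' hm ω hω n hn => hω n (hm.trans hn)
  have hDle : ∀ m, μ (D m) ≤ ENNReal.ofReal ε := by
    intro m
    have hlim : Tendsto (fun I => ENNReal.ofReal (ε + (1 - risk ε I) ^ 4 ^ I)) atTop
        (nhds (ENNReal.ofReal ε)) := by
      have := (tendsto_one_sub_risk_pow h0 h1).const_add ε
      rw [add_zero] at this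
      exact ENNReal.tendsto_ofReal this
    refine ge_of_tendsto hlim (eventually_atTop.2 ⟨m, fun I hI => ?_⟩)
    refine (measure_mono ?_).trans
      (measure_phase_avoids_target_le G next hG κ d s hd hs hmoves h0 h1 π I)
    exact fun (ω : Play S (Fin 2) (Fin 2)) (hω : ω ∈ D m) n hn => hω n
      (hI.trans ((phaseStart_strictMono.le_apply).trans (phase_eq_iff.1 hn).1))
  have hEc : μ Eᶜ ≤ ENNReal.ofReal ε := by
    rw [hE, hD.measure_iUnion]
    exact iSup_le hDle
  rw [tsub_le_iff_right]
  calc (1 : ℝ≥0∞) = μ Set.univ := measure_univ.symm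
    _ ≤ μ E + μ Eᶜ := measure_univ_le_add_compl E
    _ ≤ _ := by gcongr

include hG hd hs hmoves in
theorem hasValue_one_and_exists_phase_strategy :
    HasValue G (buchi (Fin 2) (Fin 2) {x | κ x = .w ∨ κ x = .s}) d 1 ∧
      ∀ ε : ℝ, 0 < ε → ∃ σ : MemoryStrategy S (Fin 2) (Fin 2) (ℕ × Bool),
        σ.IsOneBitMarkov ∧ σ.PlaysInPhases d s 0 ∧
        IsEpsOptimal G (buchi (Fin 2) (Fin 2) {x | κ x = .w ∨ κ x = .s}) d ε σ.toStrategy := by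
  have hds : d ≠ s := fun h => by
    have := (hs d).1 h
    rw [hd] at this
    exact BadState.noConfusion this
  have hle : lowerValue G (buchi (Fin 2) (Fin 2) {x | κ x = .w ∨ κ x = .s}) d ≤
      upperValue G (buchi (Fin 2) (Fin 2) {x | κ x = .w ∨ κ x = .s}) d :=
    iSup_iInf_le_iInf_iSup _
  have hup : upperValue G (buchi (Fin 2) (Fin 2) {x | κ x = .w ∨ κ x = .s}) d ≤ 1 :=
    (iInf_le _ fun _ => PMF.pure 0).trans (iSup_le fun _ => prob_le_one)
  have hlow : 1 ≤ lowerValue G (buchi (Fin 2) (Fin 2) {x | κ x = .w ∨ κ x = .s}) d := by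
    have hlim : Tendsto (fun n : ℕ => 1 - ENNReal.ofReal (1 / ((n : ℝ) + 1))) atTop (nhds 1) := by
      have := ENNReal.Tendsto.sub (tendsto_const_nhds (x := (1 : ℝ≥0∞)))
        (ENNReal.tendsto_ofReal (tendsto_one_div_add_atTop_nhds_zero_nat (𝕜 := ℝ)))
        (.inl ENNReal.one_ne_top)
      simpa using this
    refine le_of_tendsto' hlim fun n => ?_
    have hn0 : (0 : ℝ) < 1 / ((n : ℝ) + 1) := by positivity
    have hn1 : 1 / ((n : ℝ) + 1) ≤ 1 := by
      rw [div_le_one (by positivity)]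
      linarith [(Nat.cast_nonneg n : (0 : ℝ) ≤ n)]
    exact le_iSup_of_le (riskStrategy s hn0 hn1).toStrategy (le_iInf fun π =>
      one_sub_le_playMeasure_riskStrategy G next hG κ d s hd hs hmoves hn0 hn1 π)
  have hval : HasValue G (buchi (Fin 2) (Fin 2) {x | κ x = .w ∨ κ x = .s}) d 1 :=
    ⟨le_antisymm (hle.trans hup) hlow, le_antisymm hup (hlow.trans hle)⟩
  refine ⟨hval, fun ε hε => ?_⟩
  -- The risks are probabilities only for ε at most 1, so larger ε are cut off.
  have hm0 : 0 < min ε 1 := lt_min hε one_pos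
  refine ⟨riskStrategy s hm0 (min_le_right _ _), phaseStrategy_isOneBitMarkov _ _,
    phaseStrategy_playsInPhases _ _ hds, 1, hval, fun π => ?_⟩
  exact (tsub_le_tsub_left (ENNReal.ofReal_le_ofReal (min_le_left ε 1)) 1).trans
    (one_sub_le_playMeasure_riskStrategy G next hG κ d s hd hs hmoves hm0 (min_le_right _ _) π)

end Guarantee

/-! ### The two games as instances -/

/-- The states of the Simplified Bad Match as states of the Bad Match. -/
def SimpleState.toBadState : SimpleState → BadState
  | .d => .d
  | .l => .l
  | .s => .s
  | .t => .t

theorem badMatch_moves (x : BadState) (b : Fin 2) :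
    Moves x (badNext x 0 b) (badNext x 1 b) := by
  cases x <;> fin_cases b <;> constructor

theorem simpleBadMatch_moves (x : SimpleState) (b : Fin 2) :
    Moves x.toBadState (simpleNext x 0 b).toBadState (simpleNext x 1 b).toBadState := by
  cases x <;> fin_cases b <;> constructor

theorem badObjective_eq :
    badObjective = buchi (Fin 2) (Fin 2) {x : BadState | id x = .w ∨ id x = .s} := rfl

theorem simpleObjective_eq : simpleObjective =
    buchi (Fin 2) (Fin 2) {x : SimpleState | x.toBadState = .w ∨ x.toBadState = .s} := by
  unfold simpleObjective
  congr 1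
  ext x
  cases x <;> simp [SimpleState.toBadState]

end StochGame

theorem mainTheorem5 :
    (StochGame.HasValue StochGame.badMatch StochGame.badObjective .d 1 ∧
      ∀ ε : ℝ, 0 < ε → ∃ σ : StochGame.MemoryStrategy StochGame.BadState (Fin 2) (Fin 2) (ℕ × Bool),
        σ.IsOneBitMarkov ∧ σ.PlaysInPhases .d .s 0 ∧
        StochGame.IsEpsOptimal StochGame.badMatch StochGame.badObjective .d ε σ.toStrategy) ∧
    (StochGame.HasValue StochGame.simpleBadMatch StochGame.simpleObjective .d 1 ∧
      ∀ ε : ℝ, 0 < ε →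
        ∃ σ : StochGame.MemoryStrategy StochGame.SimpleState (Fin 2) (Fin 2) (ℕ × Bool),
        σ.IsOneBitMarkov ∧ σ.PlaysInPhases .d .s 0 ∧
        StochGame.IsEpsOptimal StochGame.simpleBadMatch StochGame.simpleObjective .d ε
          σ.toStrategy) := by
  rw [StochGame.badObjective_eq, StochGame.simpleObjective_eq]
  exact ⟨StochGame.hasValue_one_and_exists_phase_strategy StochGame.badMatch StochGame.badNext
      (fun _ _ _ => rfl) id .d .s rfl (fun _ => Iff.rfl) StochGame.badMatch_moves,
    StochGame.hasValue_one_and_exists_phase_strategy StochGame.simpleBadMatch StochGame.simpleNext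
      (fun _ _ _ => rfl) StochGame.SimpleState.toBadState .d .s rfl
      (fun x => by cases x <;> simp [StochGame.SimpleState.toBadState])
      StochGame.simpleBadMatch_moves⟩
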